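/- For each integer $m\ge 1$, let $R=R(m)\in\mathbb{R}^{m\times m}$ be a correlation matrix (a symmetric positive semi-definite matrix with unit diagonal), and let $R^+=R^+(m)$ denote the matrix with $(i,j)$ entry $\max\{R_{i,j},0\}$. Suppose that $R^+$ is positive semi-definite for all $m$, and that there are constants $\epsilon_0\in(0,1)$ and $c>0$, not depending on $m$, such that $$R_{i,j}\ \le\ 1-\epsilon_0\quad\text{for all } i\neq j,\qquad\text{and}\qquad \sum_{i\ne j}R^+_{i,j}\ \le\ c\,m$$ hold for all $m\geq 1$ (the sum being over ordered pairs of distinct indices in $\{1,\dots,m\}$). For each $m\ge 1$, let $(\zeta_1,\dots,\zeta_m)$ be a Gaussian vector drawn from $N(0,R(m))$. Then there is a constant $C>0$, not depending on $m$, such that $$\mathbb{P}\Big(\max_{1\le j\le m}\zeta_j\le\sqrt{\log m}\Big)\ \le\ C\exp\!\big(-\tfrac12 m^{1/3}\big)\qquad\text{for all } m\ge 1.$$ -/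

import Mathlib

/-- A real square matrix is a correlation matrix if it is (symmetric and) positive semi-definite
with unit diagonal. `Matrix.PosSemidef` includes symmetry. -/
structure IsCorrelationMatrix {m : ℕ} (R : Matrix (Fin m) (Fin m) ℝ) : Prop where
  posSemidef : R.PosSemidef
  diag_eq_one : ∀ i, R i i = 1

/-- The entrywise positive part `R⁺` of a matrix: its `(i, j)` entry is `max {R i j, 0}`. -/
def entrywisePosPart {m : ℕ} (R : Matrix (Fin m) (Fin m) ℝ) : Matrix (Fin m) (Fin m) ℝ :=
  Matrix.of fun i j => max (R i j) 0

/-!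
The proof thins out the index set so that the surviving coordinates are nearly independent.

Positive semi-definiteness applied to the all-ones vector gives `∑ᵢⱼ Rᵢⱼ ≥ 0`, so the negative
off-diagonal entries have total mass at most `m` plus that of the positive ones, and
`∑_{i ≠ j} |Rᵢⱼ| ≤ (2c + 1) m` (`sum_abs_offDiag_le`). This replaces a Slepian comparison of `R`
with `R⁺`: negative correlations are handled on the same footing as positive ones.
A subset `T` of at least `κ m` indices then has all its inner off-diagonal row sums at most `1/10`
(`exists_finset_sum_le_of_sum_le`).

With `σ² = 9/10`, the matrix `H = R_T - σ² I` is diagonally dominant, hence positive semi-definite,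
so `(ζ_j)_{j ∈ T}` has the law of `σ g + h` with `g` standard normal, `h ∼ N(0, H)` independent
(`multivariateGaussian_eq_conv`). Put `b = t / σ + 2` and `r = φ(b)`. Conditionally on `h`, the
event `max ζ ≤ t` has probability `∏ⱼ Φ((t - hⱼ) / σ)`, and `Φ(x) ≤ exp (r (x - b))` for all `x`
(`gaussianReal_Iic_le`) turns this product into `exp (-2 r |T| - (r / σ) ∑ⱼ hⱼ)`. Its expectation
is an exponential moment of one Gaussian variable of variance `∑ᵢⱼ Hᵢⱼ ≤ |T| / 5`, and since
`r ≤ 1/2` the result is at most `exp (-r |T|)`. For `t = √(log m)` the density `r` is at least a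
constant times `m ^ (-3/5)`, which leaves `exp (-k m ^ (2/5))`, and `2/5 > 1/3`.
-/

open MeasureTheory ProbabilityTheory Finset
open scoped Matrix

/-! ### Thinning the index set -/

/-- A nonnegative symmetric weight of total mass at most `K |ι|` has an induced subset `T` of
proportional size in which every vertex has weighted degree at most `η`. -/
theorem exists_finset_sum_le_of_sum_le {ι : Type*} [Fintype ι] [DecidableEq ι]
    (B : ι → ι → ℝ) (hB0 : ∀ i j, 0 ≤ B i j) (hdiag : ∀ i, B i i = 0)
    (hsymm : ∀ i j, B i j = B j i) {K η : ℝ} (hK : 0 < K) (hη : 0 < η)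
    (hsum : ∑ i, ∑ j, B i j ≤ K * Fintype.card ι) :
    ∃ T : Finset ι, (∀ i ∈ T, ∑ j ∈ T, B i j ≤ η) ∧
      η / (2 * (2 * K + η)) * Fintype.card ι ≤ #T := by
  classical
  -- `T` maximises the potential `F` among the sets of vertices of degree at most `2 * K`: that no
  -- vertex is worth removing bounds the degrees inside `T`, and that none is worth adding bounds
  -- `#T` from below.
  set S : Finset ι := univ.filter fun i => ∑ j, B i j ≤ 2 * K with hS
  let F : Finset ι → ℝ := fun T => η * #T - (∑ i ∈ T, ∑ j ∈ T, B i j) / 2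
  have hF : ∀ T i, i ∉ T → F (insert i T) = F T + (η - ∑ j ∈ T, B i j) := by
    intro T i hi
    have h1 : ∑ x ∈ T, B x i = ∑ x ∈ T, B i x := sum_congr rfl fun x _ => hsymm x i
    simp only [F, sum_insert hi, card_insert_of_notMem hi, sum_add_distrib, hdiag, h1]
    push_cast
    ring
  obtain ⟨T, hTS, hT⟩ := S.powerset.exists_max_image F ⟨∅, empty_mem_powerset S⟩
  rw [mem_powerset] at hTS
  have hin : ∀ i ∈ T, ∑ j ∈ T, B i j ≤ η := by
    intro i hi
    have h1 := hF (T.erase i) i (notMem_erase i T)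
    have h2 := hT (T.erase i) (mem_powerset.2 ((erase_subset i T).trans hTS))
    rw [insert_erase hi] at h1
    have h3 := sum_erase_add T (B i) hi
    rw [hdiag] at h3
    linarith
  have hout : ∀ i ∈ S \ T, η ≤ ∑ j ∈ T, B i j := by
    intro i hi
    rw [mem_sdiff] at hi
    have h1 := hF T i hi.2
    have h2 := hT (insert i T) (mem_powerset.2 (insert_subset hi.1 hTS))
    linarith
  refine ⟨T, hin, ?_⟩
  have hcount : η * (#S - #T) ≤ 2 * K * #T := by
    have hc : (#(S \ T) : ℝ) = #S - #T := by
      rw [card_sdiff_of_subset hTS, Nat.cast_sub (card_le_card hTS)]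
    calc η * (#S - #T) = ∑ i ∈ S \ T, η := by rw [sum_const, nsmul_eq_mul, hc, mul_comm]
      _ ≤ ∑ i ∈ S \ T, ∑ j ∈ T, B i j := sum_le_sum hout
      _ = ∑ j ∈ T, ∑ i ∈ S \ T, B j i := by
        rw [sum_comm]
        exact sum_congr rfl fun j _ => sum_congr rfl fun i _ => hsymm i j
      _ ≤ ∑ j ∈ T, ∑ i, B j i := sum_le_sum fun j _ =>
        sum_le_sum_of_subset_of_nonneg (subset_univ _) fun i _ _ => hB0 j i
      _ ≤ ∑ j ∈ T, 2 * K := sum_le_sum fun j hj => (mem_filter.1 (hTS hj)).2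
      _ = 2 * K * #T := by rw [sum_const, nsmul_eq_mul, mul_comm]
  -- Markov's inequality for the degrees.
  have hSc : (Fintype.card ι : ℝ) ≤ 2 * #S := by
    have hc : (#(univ \ S) : ℝ) = Fintype.card ι - #S := by
      rw [card_sdiff_of_subset (subset_univ S), Nat.cast_sub (card_le_card (subset_univ S)),
        card_univ]
    have : 2 * K * (Fintype.card ι - #S) ≤ K * Fintype.card ι := by
      calc 2 * K * (Fintype.card ι - #S) = ∑ i ∈ univ \ S, 2 * K := by
            rw [sum_const, nsmul_eq_mul, hc, mul_comm]
        _ ≤ ∑ i ∈ univ \ S, ∑ j, B i j := sum_le_sum fun i hi => by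
            simp only [hS, mem_sdiff, mem_filter, mem_univ, true_and, not_le] at hi
            exact hi.le
        _ ≤ ∑ i, ∑ j, B i j := sum_le_sum_of_subset_of_nonneg (subset_univ _)
            fun i _ _ => sum_nonneg fun j _ => hB0 i j
        _ ≤ _ := hsum
    have h2 : K * (Fintype.card ι) ≤ K * (2 * #S) := by linarith
    exact le_of_mul_le_mul_left h2 hK
  rw [div_mul_eq_mul_div, div_le_iff₀ (by positivity)]
  nlinarith

/-- For a correlation matrix the positive off-diagonal entries control the negative ones, because
the sum of all entries is nonnegative. -/
theorem sum_abs_offDiag_le {ι : Type*} [Fintype ι] [DecidableEq ι] {R : Matrix ι ι ℝ}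
    (hR : R.PosSemidef) (hdiag : ∀ i, R i i = 1) {c : ℝ}
    (hsum : ∑ i, ∑ j with i ≠ j, max (R i j) 0 ≤ c * Fintype.card ι) :
    ∑ i, ∑ j, (if i = j then 0 else |R i j|) ≤ (2 * c + 1) * Fintype.card ι := by
  have h1 : 0 ≤ ∑ i, ∑ j, R i j := by
    have := hR.dotProduct_mulVec_nonneg (fun _ => (1 : ℝ))
    simpa [dotProduct, Matrix.mulVec] using this
  have h2 : ∀ i j, (if i = j then 0 else |R i j|) =
      2 * (if i ≠ j then max (R i j) 0 else 0) - R i j + if i = j then 1 else 0 := by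
    intro i j
    by_cases h : i = j
    · subst h; simp [hdiag]
    · rcases le_total (R i j) 0 with h0 | h0
      · simp [h, h0, abs_of_nonpos]
      · simp [h, h0, abs_of_nonneg]; ring
  simp_rw [sum_filter] at hsum
  simp_rw [h2, sum_add_distrib, sum_sub_distrib, ← mul_sum]
  simp only [sum_ite_eq, mem_univ, if_true, sum_const, card_univ, nsmul_eq_mul, mul_one]
  linarith

/-- A diagonally dominant symmetric matrix is positive semi-definite. -/
theorem posSemidef_of_sum_abs_offDiag_le {ι : Type*} [Fintype ι] [DecidableEq ι]
    {H : Matrix ι ι ℝ} (hH : H.IsHermitian)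
    (hdom : ∀ i, ∑ j, (if i = j then 0 else |H i j|) ≤ H i i) : H.PosSemidef := by
  have hs : ∀ i j, H i j = H j i := fun i j => by simpa using (hH.apply i j).symm
  refine Matrix.PosSemidef.of_dotProduct_mulVec_nonneg hH fun x => ?_
  have h1 : ∀ i j, (if i = j then H i i * x i ^ 2 else 0)
      - (if i = j then 0 else |H i j|) * (x i ^ 2 + x j ^ 2) / 2 ≤ x i * (H i j * x j) := by
    intro i j
    by_cases h : i = j
    · subst h; simp; nlinarith
    · simp only [h, if_false]
      nlinarith [mul_nonneg (sub_nonneg.2 (le_abs_self (H i j))) (sq_nonneg (x i - x j)),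
        mul_nonneg (sub_nonneg.2 (neg_abs_le (H i j))) (sq_nonneg (x i + x j))]
  have h2 : ∑ i, ∑ j, (if i = j then 0 else |H i j|) * (x i ^ 2 + x j ^ 2) / 2 =
      ∑ i, (∑ j, if i = j then 0 else |H i j|) * x i ^ 2 := by
    have h3 : ∑ i, ∑ j, (if i = j then 0 else |H i j|) * x j ^ 2 =
        ∑ i, ∑ j, (if i = j then 0 else |H i j|) * x i ^ 2 := by
      rw [sum_comm]
      simp_rw [hs, eq_comm]
    simp_rw [mul_add, add_div, sum_add_distrib, ← sum_div, h3, sum_mul]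
    ring
  have h4 : 0 ≤ ∑ i, ∑ j, x i * (H i j * x j) := by
    refine le_trans ?_ (sum_le_sum fun i _ => sum_le_sum fun j _ => h1 i j)
    simp_rw [sum_sub_distrib]
    rw [h2, ← sum_sub_distrib]
    refine sum_nonneg fun i _ => ?_
    simp only [sum_ite_eq, mem_univ, if_true]
    nlinarith [hdom i, sq_nonneg (x i), mul_nonneg (sub_nonneg.2 (hdom i)) (sq_nonneg (x i))]
  simpa [dotProduct, Matrix.mulVec, mul_sum] using h4

/-! ### The standard normal distribution function -/

theorem gaussianPDFReal_le_half (x : ℝ) : gaussianPDFReal 0 1 x ≤ 1 / 2 := by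
  rw [gaussianPDFReal]
  have h1 : (2 : ℝ) ≤ √(2 * Real.pi * (1 : NNReal)) := by
    refine Real.le_sqrt_of_sq_le ?_
    push_cast
    linarith [Real.pi_gt_three]
  have h2 : Real.exp (-(x - 0) ^ 2 / (2 * (1 : NNReal))) ≤ 1 :=
    Real.exp_le_one_iff.2 (div_nonpos_of_nonpos_of_nonneg (by nlinarith [sq_nonneg (x - 0)])
      (by positivity))
  calc _ ≤ (2 : ℝ)⁻¹ * 1 := by gcongr
    _ = 1 / 2 := by norm_num

/-- The line `x ↦ r (x - b)` of slope `r = φ(b)` lies above `log Φ`, where `φ` and `Φ` are the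
standard normal density and distribution function. It stands in for a tangent line of the
concave function `log Φ`. -/
theorem gaussianReal_Iic_le {b : ℝ} (hb : 2 ≤ b) (x : ℝ) :
    gaussianReal 0 1 (Set.Iic x) ≤
      ENNReal.ofReal (Real.exp (gaussianPDFReal 0 1 b * (x - b))) := by
  set r := gaussianPDFReal 0 1 b with hr
  have hr0 : 0 ≤ r := gaussianPDFReal_nonneg _ _ _
  have hr1 : r ≤ 1 / 2 := gaussianPDFReal_le_half b
  rw [ENNReal.le_ofReal_iff_toReal_le (measure_ne_top _ _) (Real.exp_pos _).le]
  change (gaussianReal 0 1).real (Set.Iic x) ≤ _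
  rcases le_or_gt b x with h | h
  · exact measureReal_le_one.trans (Real.one_le_exp (mul_nonneg hr0 (by linarith)))
  rcases lt_or_ge x (-b) with h' | h'
  -- In the far left tail the Chernoff bound `exp (-x ^ 2 / 2)` suffices.
  · have := measure_le_le_exp_mul_mgf (μ := gaussianReal 0 1) (X := id) (t := x) x (by linarith)
      (integrable_exp_mul_gaussianReal x)
    rw [mgf_id_gaussianReal, ← Real.exp_add] at this
    refine this.trans (Real.exp_le_exp.2 ?_)
    simp
    nlinarith
  -- The density is at least `r = φ(b)` on `[-b, b]`, so `Φ(x) ≤ 1 - r (b - x)`.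
  · have h1 : r * (b - x) ≤ (gaussianReal 0 1).real (Set.Ioc x b) := by
      rw [measureReal_def, gaussianReal_apply_eq_integral _ one_ne_zero,
        ENNReal.toReal_ofReal (integral_nonneg fun y => gaussianPDFReal_nonneg _ _ _)]
      have : r * (b - x) = ∫ y in Set.Ioc x b, r := by
        simp [measureReal_def, ENNReal.toReal_ofReal (sub_nonneg.2 h.le), mul_comm]
      rw [this]
      refine setIntegral_mono_on (by simp) (integrable_gaussianPDFReal 0 1).integrableOn
        measurableSet_Ioc fun y hy => ?_
      rw [hr, gaussianPDFReal, gaussianPDFReal]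
      have : y ^ 2 ≤ b ^ 2 := sq_le_sq' (by linarith [hy.1]) hy.2
      gcongr ?_ * Real.exp (?_ / _)
      simpa using this
    have h2 : (gaussianReal 0 1).real (Set.Iic x) + (gaussianReal 0 1).real (Set.Ioc x b) ≤ 1 := by
      have hd : Disjoint (Set.Iic x) (Set.Ioc x b) :=
        Set.disjoint_left.2 fun y hy hy' => not_lt.2 hy hy'.1
      rw [← measureReal_union hd measurableSet_Ioc]
      exact measureReal_le_one
    have h3 := Real.add_one_le_exp (r * (x - b))
    linarith

/-! ### Gaussian vectors -/

theorem multivariateGaussian_map_comp {ι κ : Type*} [Fintype ι] [DecidableEq ι] [Fintype κ]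
    [DecidableEq κ] {S : Matrix ι ι ℝ} (hS : S.PosSemidef) (e : κ → ι) :
    (multivariateGaussian 0 S).map (fun x => WithLp.toLp 2 fun j => x (e j)) =
      multivariateGaussian 0 (S.submatrix e e) := by
  let L : EuclideanSpace ℝ ι →L[ℝ] EuclideanSpace ℝ κ :=
    ((EuclideanSpace.equiv κ ℝ).symm : (κ → ℝ) →L[ℝ] EuclideanSpace ℝ κ) ∘L
      ContinuousLinearMap.pi fun j => EuclideanSpace.proj (e j)
  change (multivariateGaussian 0 S).map L = _
  apply IsGaussian.ext
  · simp only [id_eq, integral_id_multivariateGaussian]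
    rw [ContinuousLinearMap.integral_id_map, integral_id_multivariateGaussian, map_zero]
    exact IsGaussian.integrable_id
  rw [← ContinuousLinearMap.toBilinForm_inj]
  refine LinearMap.BilinForm.ext_basis (EuclideanSpace.basisFun κ ℝ).toBasis fun i j ↦ ?_
  rw [ContinuousLinearMap.toBilinForm_apply, ContinuousLinearMap.toBilinForm_apply,
    covarianceBilin_apply_eq_cov, covariance_map]
  · have (i : κ) : (fun u ↦ inner ℝ ((EuclideanSpace.basisFun κ ℝ).toBasis i) u) ∘ L =
        fun u ↦ u (e i) := by ext; simp [PiLp.inner_apply, L]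
    simp_rw [this, covariance_eval_multivariateGaussian hS,
      covarianceBilin_multivariateGaussian (hS.submatrix _)]
    simp
  any_goals exact Measurable.aestronglyMeasurable (by fun_prop)
  · fun_prop
  · exact IsGaussian.memLp_two_id

/-- A Gaussian vector with covariance `σ² I + H` is `σ` times a standard one plus an independent
one with covariance `H`. -/
theorem multivariateGaussian_eq_conv {ι : Type*} [Fintype ι] [DecidableEq ι] {H : Matrix ι ι ℝ}
    (hH : H.PosSemidef) (σ : ℝ) :
    multivariateGaussian 0 (σ ^ 2 • 1 + H) =
      ((stdGaussian (EuclideanSpace ℝ ι)).map (σ • ·)) ∗ multivariateGaussian 0 H := by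
  have hs : (σ ^ 2 • 1 + H).PosSemidef :=
    (Matrix.PosSemidef.one.smul (sq_nonneg σ)).add hH
  have : IsProbabilityMeasure ((stdGaussian (EuclideanSpace ℝ ι)).map (σ • ·)) :=
    Measure.isProbabilityMeasure_map (by fun_prop)
  apply Measure.ext_of_charFun
  ext x
  rw [charFun_conv, charFun_map_smul, charFun_stdGaussian, charFun_multivariateGaussian hs,
    charFun_multivariateGaussian hH, ← Complex.exp_add]
  have hq : x ⬝ᵥ (σ ^ 2 • 1 + H) *ᵥ x = ‖σ • x‖ ^ 2 + x ⬝ᵥ H *ᵥ x := by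
    rw [norm_smul, mul_pow, Real.norm_eq_abs, sq_abs, EuclideanSpace.real_norm_sq_eq,
      Matrix.add_mulVec, dotProduct_add, Matrix.smul_mulVec, Matrix.one_mulVec, dotProduct_smul]
    simp [dotProduct, sq]
  rw [hq]
  congr 1
  push_cast
  ring

theorem measurableSet_forall_le {ι : Type*} [Fintype ι] (a : ι → ℝ) :
    MeasurableSet {x : EuclideanSpace ℝ ι | ∀ j, x j ≤ a j} := by
  rw [Set.ofPred_forall]
  exact MeasurableSet.iInter fun j => measurableSet_le (by fun_prop) (by fun_prop)

theorem stdGaussian_forall_le {ι : Type*} [Fintype ι] {σ : ℝ} (hσ : 0 < σ) (a : ι → ℝ) :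
    (stdGaussian (EuclideanSpace ℝ ι)).map (σ • ·) {x | ∀ j, x j ≤ a j} =
      ∏ j, gaussianReal 0 1 (Set.Iic (a j / σ)) := by
  have hm : MeasurableSet {x : EuclideanSpace ℝ ι | ∀ j, x j ≤ a j} :=
    measurableSet_forall_le _
  rw [Measure.map_apply (by fun_prop) hm, ← map_pi_eq_stdGaussian,
    Measure.map_apply (by fun_prop) (hm.preimage (by fun_prop)), ← Measure.pi_pi]
  congr 1
  ext x
  simp [Pi.le_def, le_div_iff₀' hσ]

theorem multivariateGaussian_map_sum {ι : Type*} [Fintype ι] [DecidableEq ι] {H : Matrix ι ι ℝ}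
    (hH : H.PosSemidef) :
    (multivariateGaussian 0 H).map (fun x => ∑ j, x j) =
      gaussianReal 0 (∑ i, ∑ j, H i j).toNNReal := by
  let L : StrongDual ℝ (EuclideanSpace ℝ ι) := ∑ j, EuclideanSpace.proj j
  have hL : (fun x : EuclideanSpace ℝ ι => ∑ j, x j) = L := by
    ext x
    simp [L]
  have hv : Var[L; multivariateGaussian 0 H] = ∑ i, ∑ j, H i j := by
    rw [← hL, variance_fun_sum]
    · simp_rw [covariance_eval_multivariateGaussian hH]
    · exact fun i => IsGaussian.memLp_dual _ (EuclideanSpace.proj (𝕜 := ℝ) i) 2 (by simp)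
  rw [hL, IsGaussian.map_eq_gaussianReal, hv,
    L.integral_comp_id_comm IsGaussian.integrable_id, integral_id_multivariateGaussian, map_zero]

/-- Lower-tail bound for the maximum when the covariance dominates `σ² I`: condition on the part with
covariance `H`, and linearise `log Φ` so that only the sum of that part matters. -/
theorem multivariateGaussian_forall_le {ι : Type*} [Fintype ι] [DecidableEq ι] {H : Matrix ι ι ℝ}
    (hH : H.PosSemidef) {σ t : ℝ} (hσ : 0 < σ) (ht : 0 ≤ t) :
    (multivariateGaussian 0 (σ ^ 2 • 1 + H)).real {x | ∀ j, x j ≤ t} ≤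
      Real.exp (-2 * gaussianPDFReal 0 1 (t / σ + 2) * Fintype.card ι +
        (∑ i, ∑ j, H i j) * (gaussianPDFReal 0 1 (t / σ + 2) / σ) ^ 2 / 2) := by
  set r := gaussianPDFReal 0 1 (t / σ + 2) with hr
  have hb : 2 ≤ t / σ + 2 := by have := div_nonneg ht hσ.le; linarith
  have hm : MeasurableSet {x : EuclideanSpace ℝ ι | ∀ j, x j ≤ t} :=
    measurableSet_forall_le _
  have : IsProbabilityMeasure ((stdGaussian (EuclideanSpace ℝ ι)).map (σ • ·)) :=
    Measure.isProbabilityMeasure_map (by fun_prop)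
  have hV : 0 ≤ ∑ i, ∑ j, H i j := by
    have := hH.dotProduct_mulVec_nonneg (fun _ => (1 : ℝ))
    simpa [dotProduct, Matrix.mulVec] using this
  refine ENNReal.toReal_le_of_le_ofReal (Real.exp_pos _).le ?_
  have hlaw := multivariateGaussian_map_sum hH
  have hmgf := mgf_gaussianReal hlaw (-(r / σ))
  have hint : Integrable (fun x : EuclideanSpace ℝ ι => Real.exp (-(r / σ) * ∑ j, x j))
      (multivariateGaussian 0 H) := by
    have h := integrable_exp_mul_gaussianReal (μ := 0) (v := (∑ i, ∑ j, H i j).toNNReal) (-(r / σ))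
    rw [← hlaw] at h
    exact h.comp_measurable (by fun_prop)
  rw [multivariateGaussian_eq_conv hH]
  calc _ = ∫⁻ y, ∏ j, gaussianReal 0 1 (Set.Iic ((t - y j) / σ)) ∂(multivariateGaussian 0 H) := by
        rw [Measure.conv_comm, Measure.conv, Measure.map_apply (by fun_prop) hm,
          Measure.prod_apply (hm.preimage (by fun_prop))]
        refine lintegral_congr fun y => ?_
        rw [← stdGaussian_forall_le hσ]
        congr 1
        ext x
        simp [le_sub_iff_add_le']
    _ ≤ ∫⁻ y, ENNReal.ofReal (Real.exp (-2 * r * Fintype.card ι) *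
          Real.exp (-(r / σ) * ∑ j, y j)) ∂(multivariateGaussian 0 H) := by
        refine lintegral_mono fun y => ?_
        refine (prod_le_prod' fun j _ => gaussianReal_Iic_le hb _).trans_eq ?_
        rw [← ENNReal.ofReal_prod_of_nonneg (fun j _ => (Real.exp_pos _).le), ← Real.exp_sum,
          ← Real.exp_add, ← hr]
        congr 2
        have h1 : ∀ j, r * ((t - y j) / σ - (t / σ + 2)) = -2 * r + -(r / σ) * y j :=
          fun j => by ring
        simp_rw [h1, sum_add_distrib, ← mul_sum]
        simp only [sum_const, card_univ, nsmul_eq_mul]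
        ring
    _ = _ := by
        rw [← ofReal_integral_eq_lintegral_ofReal (hint.const_mul _)
          (ae_of_all _ fun y => by positivity), integral_const_mul, Real.exp_add]
        congr 2
        rw [mgf] at hmgf
        rw [hmgf]
        simp [Real.coe_toNNReal _ hV]

/-! ### Powers of the dimension -/

theorem exists_exp_neg_mul_rpow_le {k : ℝ} (hk : 0 < k) :
    ∃ C : ℝ, 0 < C ∧ ∀ x : ℝ, 1 ≤ x → Real.exp (-(k * x ^ (2 / 5 : ℝ))) ≤
      C * Real.exp (-(1 / 2 : ℝ) * x ^ (1 / 3 : ℝ)) := by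
  refine ⟨Real.exp ((1 / (2 * k)) ^ (5 : ℝ) / 2), Real.exp_pos _, fun x hx => ?_⟩
  rw [← Real.exp_add, Real.exp_le_exp]
  have hx0 : 0 < x := by linarith
  set y := x ^ (1 / 3 : ℝ) with hy
  have hy0 : 0 < y := Real.rpow_pos_of_pos hx0 _
  have h1 : x ^ (2 / 5 : ℝ) = y * y ^ (1 / 5 : ℝ) := by
    rw [hy, ← Real.rpow_mul hx0.le, ← Real.rpow_add hx0]
    norm_num
  rw [h1]
  rcases le_total y ((1 / (2 * k)) ^ (5 : ℝ)) with h | h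
  · have : 0 ≤ k * (y * y ^ (1 / 5 : ℝ)) := by positivity
    linarith
  · have h2 : 1 / (2 * k) ≤ y ^ (1 / 5 : ℝ) := by
      have := Real.rpow_le_rpow (by positivity) h (by norm_num : (0 : ℝ) ≤ 1 / 5)
      rwa [← Real.rpow_mul (by positivity), show (5 : ℝ) * (1 / 5) = 1 by norm_num,
        Real.rpow_one] at this
    have h3 : k * (1 / (2 * k)) ≤ k * y ^ (1 / 5 : ℝ) := by gcongr
    rw [show k * (1 / (2 * k)) = 1 / 2 by field_simp] at h3
    have h4 : 0 ≤ (1 / (2 * k)) ^ (5 : ℝ) := by positivity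
    nlinarith

/-- At `u + 2` with `u ^ 2 = (10 / 9) log x`, the exponent is `(u + 2) ^ 2 / 2`, in which the cross
term `2 u` is at most `u ^ 2 / 25 + 25`. -/
theorem gaussianPDFReal_sqrt_log_ge {x : ℝ} (hx : 1 ≤ x) :
    (√(2 * Real.pi))⁻¹ * Real.exp (-27) * x ^ (-(3 / 5) : ℝ) ≤
      gaussianPDFReal 0 1 (√(Real.log x) / √(9 / 10) + 2) := by
  have hx0 : 0 < x := by linarith
  rw [gaussianPDFReal, Real.rpow_def_of_pos hx0, mul_assoc, ← Real.exp_add]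
  simp only [NNReal.coe_one, mul_one, sub_zero]
  gcongr
  set u := √(Real.log x) / √(9 / 10) with hu
  have h1 : Real.log x = 9 / 10 * u ^ 2 := by
    rw [hu, div_pow, Real.sq_sqrt (Real.log_nonneg hx), Real.sq_sqrt (by norm_num)]
    ring
  rw [h1]
  nlinarith [sq_nonneg (u - 25)]

/-! ### The tail bound for correlation matrices -/

/-- The bound on the maximum is applied to the coordinates in a thinned index set, where the
covariance is `σ² I` plus a diagonally dominant matrix. -/
theorem multivariateGaussian_forall_le_of_sum_posPart_le {ι : Type*} [Fintype ι] [DecidableEq ι]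
    {R : Matrix ι ι ℝ} (hR : R.PosSemidef) (hdiag : ∀ i, R i i = 1) {c : ℝ} (hc : 0 < c)
    (hsum : ∑ i, ∑ j with i ≠ j, max (R i j) 0 ≤ c * Fintype.card ι) {σ t : ℝ} (hσ0 : 0 < σ)
    (hσ : σ ^ 2 = 9 / 10) (ht : 0 ≤ t) :
    (multivariateGaussian 0 R).real {x | ∀ j, x j ≤ t} ≤
      Real.exp (-(gaussianPDFReal 0 1 (t / σ + 2) *
        (1 / 10 / (2 * (2 * (2 * c + 1) + 1 / 10)) * Fintype.card ι))) := by
  have hRs : ∀ i j, R i j = R j i := fun i j => by simpa using (hR.1.apply i j).symm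
  obtain ⟨T, hT, hcard⟩ := exists_finset_sum_le_of_sum_le
    (fun i j => if i = j then 0 else |R i j|) (fun i j => by positivity) (by simp)
    (fun i j => by simp_rw [hRs i j, eq_comm]) (by positivity : 0 < 2 * c + 1)
    (by norm_num : (0 : ℝ) < 1 / 10) (sum_abs_offDiag_le hR hdiag hsum)
  set A : Matrix T T ℝ := R.submatrix (↑) (↑) with hA
  set H : Matrix T T ℝ := A - σ ^ 2 • 1 with hH
  have hHdiag : ∀ i, H i i = 1 / 10 := fun i => by simp [hH, hA, hdiag, hσ]; norm_num
  have hHoff : ∀ i, ∑ j, (if i = j then 0 else |H i j|) ≤ 1 / 10 := by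
    intro i
    refine le_trans (le_of_eq ?_) (hT i i.2)
    rw [← sum_coe_sort T]
    refine sum_congr rfl fun j _ => ?_
    by_cases h : i = j
    · simp [h]
    · simp [h, hH, hA]
  have hHpsd : H.PosSemidef := by
    refine posSemidef_of_sum_abs_offDiag_le ?_ fun i => (hHoff i).trans_eq (hHdiag i).symm
    exact (hR.1.submatrix _).sub (Matrix.isHermitian_one.smul (.all _))
  have hV : ∑ i, ∑ j, H i j ≤ #T * (1 / 5) := by
    calc _ ≤ ∑ i : T, (1 / 5 : ℝ) := sum_le_sum fun i _ => by
          calc ∑ j, H i j ≤ ∑ j, ((if i = j then 0 else |H i j|) +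
                  if i = j then 1 / 10 else 0) := sum_le_sum fun j _ => by
                by_cases h : i = j
                · subst h; simp [hHdiag]
                · simp [h, le_abs_self]
            _ ≤ 1 / 10 + 1 / 10 := by
                rw [sum_add_distrib]
                exact add_le_add (hHoff i) (by simp)
            _ = 1 / 5 := by norm_num
      _ = _ := by simp
  set r := gaussianPDFReal 0 1 (t / σ + 2) with hr
  have hr0 : 0 ≤ r := gaussianPDFReal_nonneg _ _ _
  have hr1 : r ≤ 1 / 2 := gaussianPDFReal_le_half _
  have hm : MeasurableSet {x : EuclideanSpace ℝ T | ∀ j, x j ≤ t} :=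
    measurableSet_forall_le _
  calc (multivariateGaussian 0 R).real {x | ∀ j, x j ≤ t}
      ≤ (multivariateGaussian 0 R).real
          ((fun x => WithLp.toLp 2 fun j : T => x j) ⁻¹' {x | ∀ j, x j ≤ t}) :=
        measureReal_mono fun x hx j => hx j
    _ = (multivariateGaussian 0 (σ ^ 2 • 1 + H)).real {x | ∀ j, x j ≤ t} := by
        rw [← map_measureReal_apply (by fun_prop) hm, multivariateGaussian_map_comp hR, hH,
          add_sub_cancel]
    _ ≤ _ := multivariateGaussian_forall_le hHpsd hσ0 ht
    _ ≤ _ := by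
        rw [Real.exp_le_exp, ← hr, Fintype.card_coe, div_pow, hσ]
        have h1 : (∑ i, ∑ j, H i j) * (r ^ 2 / (9 / 10)) ≤ #T * (1 / 5) * (r ^ 2 / (9 / 10)) := by
          gcongr
        have h2 : #T * r ^ 2 ≤ #T * (r * (1 / 2)) := by rw [sq]; gcongr
        have h3 := mul_le_mul_of_nonneg_left hcard hr0
        have h4 : 0 ≤ #T * r := by positivity
        nlinarith

theorem lemmaD3
    (R : ∀ m : ℕ, Matrix (Fin m) (Fin m) ℝ)
    (hR : ∀ m : ℕ, 1 ≤ m → IsCorrelationMatrix (R m))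
    (hRpos : ∀ m : ℕ, 1 ≤ m → (entrywisePosPart (R m)).PosSemidef)
    (ε₀ c : ℝ) (hε₀ : ε₀ ∈ Set.Ioo (0 : ℝ) 1) (hc : 0 < c)
    (hmax : ∀ m : ℕ, 1 ≤ m → ∀ i j : Fin m, i ≠ j → R m i j ≤ 1 - ε₀)
    (hsum : ∀ m : ℕ, 1 ≤ m →
      ∑ i : Fin m, ∑ j : Fin m with i ≠ j, entrywisePosPart (R m) i j ≤ c * (m : ℝ))
    (Ω : ℕ → Type*) [∀ m, MeasurableSpace (Ω m)]
    (P : ∀ m : ℕ, MeasureTheory.Measure (Ω m))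
    (ζ : ∀ m : ℕ, Ω m → EuclideanSpace ℝ (Fin m))
    (hζ : ∀ m : ℕ, 1 ≤ m →
      ProbabilityTheory.HasLaw (ζ m) (ProbabilityTheory.multivariateGaussian 0 (R m)) (P m)) :
    ∃ C : ℝ, 0 < C ∧ ∀ m : ℕ, 1 ≤ m →
      (P m).real {ω | (⨆ j : Fin m, ζ m ω j) ≤ Real.sqrt (Real.log (m : ℝ))}
        ≤ C * Real.exp (-(1 / 2 : ℝ) * (m : ℝ) ^ (1 / 3 : ℝ)) := by
  set κ : ℝ := 1 / 10 / (2 * (2 * (2 * c + 1) + 1 / 10)) with hκ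
  have hκ0 : 0 < κ := by positivity
  obtain ⟨C, hC, hbound⟩ := exists_exp_neg_mul_rpow_le
    (by positivity : 0 < (√(2 * Real.pi))⁻¹ * Real.exp (-27) * κ)
  refine ⟨C, hC, fun m hm => ?_⟩
  have hm1 : (1 : ℝ) ≤ m := by exact_mod_cast hm
  have : Nonempty (Fin m) := ⟨⟨0, hm⟩⟩
  have hmeas : MeasurableSet {x : EuclideanSpace ℝ (Fin m) | ∀ j, x j ≤ √(Real.log m)} :=
    measurableSet_forall_le _
  simp_rw [ciSup_le_iff (Set.finite_range _).bddAbove]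
  rw [(hζ m hm).measureReal_eq hmeas]
  refine (multivariateGaussian_forall_le_of_sum_posPart_le (hR m hm).posSemidef
    (hR m hm).diag_eq_one hc (by simpa [entrywisePosPart] using hsum m hm) (σ := √(9 / 10))
    (by positivity) (Real.sq_sqrt (by norm_num)) (Real.sqrt_nonneg _)).trans
    (le_trans ?_ (hbound m hm1))
  rw [Real.exp_le_exp, neg_le_neg_iff, ← hκ, Fintype.card_fin]
  have hpow : (m : ℝ) ^ (2 / 5 : ℝ) = m ^ (-(3 / 5) : ℝ) * m := by
    rw [← Real.rpow_add_one (by positivity)]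
    norm_num
  calc _ = (√(2 * Real.pi))⁻¹ * Real.exp (-27) * (m : ℝ) ^ (-(3 / 5) : ℝ) * (κ * m) := by
        rw [hpow]; ring
    _ ≤ _ := by
        gcongr
        exact gaussianPDFReal_sqrt_log_ge hm1
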